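/- Let $n\ge 1$ and let $C\in\mathbb{R}_{\ge0}^{n\times n}$ be an irreducible nonnegative matrix. For each $T>0$ let $g_T:[0,1]\to\mathbb{R}_{>0}$ be a continuously differentiable increasing function with $g_T(0)=1$ and $g_T'(x)>0$ for all $x\in[0,1]$, and suppose that $$\lim_{T\to0^+}\ \min_{x\in[0,1]}\frac{g_T'(x)}{g_T(x)}=\infty,\qquad \lim_{T\to\infty}\ \max_{x\in[0,1]}\frac{g_T'(x)}{g_T(x)}=0 .$$ Let $\Sigma=\{x\in\mathbb{R}^n_{\ge0}:\sum_i x_i=1\}$, regarded as a set of row vectors. For $x\in\Sigma$ and $T>0$ let $M_T(x)$ be the irreducible stochastic matrix with entries $$M_T(x)_{ij}=\frac{C_{ij}\,g_T(x_j)}{\sum_k C_{ik}\,g_T(x_k)},$$ and let $u_T(x)\in\Sigma$ be its unique invariant measure, that is, the unique $u\in\Sigma$ with $u\,M_T(x)=u$. For $\varepsilon>0$ put $\Sigma_\varepsilon=\{x\in\Sigma: x_1\ge 1-\varepsilon\}$. (1) Assume that every entry of the first column of $C$ is positive. Then for every $0<\varepsilon<\frac12$ there exists $T_\varepsilon>0$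 such that for all $0<T\le T_\varepsilon$ the map $u_T:\Sigma\to\Sigma$ has a fixed point in $\Sigma_\varepsilon$. (2) Assume only that $C_{11}>0$, and that there is $\varepsilon_n\in(0,1]$, independent of $T$, such that $g_T(\varepsilon_n)^{n-1}\le g_T(1-\varepsilon_n)$ for all $T>0$. Then for every $0<\varepsilon<\varepsilon_n$ there exists $T_\varepsilon>0$ such that for all $0<T\le T_\varepsilon$ the map $u_T$ has a fixed point in $\Sigma_\varepsilon$. -/

import Mathlib

open Set Filter Topology

noncomputable section

/-- The minimum over `[0,1]` of the logarithmic derivative `g' / g`. -/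
def lipMin (g : ℝ → ℝ) : ℝ :=
  sInf ((fun x => derivWithin g (Icc 0 1) x / g x) '' Icc 0 1)

/-- The maximum over `[0,1]` of the logarithmic derivative `g' / g`. -/
def lipMax (g : ℝ → ℝ) : ℝ :=
  sSup ((fun x => derivWithin g (Icc 0 1) x / g x) '' Icc 0 1)

/-- A family `(g_T)`, `T > 0`, of weight functions `g_T : [0,1] → ℝ_{>0}`. Each `g_T` is
represented by a function on `ℝ`; only its restriction to `[0,1]`, and only the temperatures
`T > 0`, are constrained and used. -/
structure IsWeightFamily (g : ℝ → ℝ → ℝ) : Prop where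
  pos : ∀ T, 0 < T → ∀ x ∈ Icc (0 : ℝ) 1, 0 < g T x
  contDiffOn : ∀ T, 0 < T → ContDiffOn ℝ 1 (g T) (Icc 0 1)
  map_zero : ∀ T, 0 < T → g T 0 = 1
  strictMonoOn : ∀ T, 0 < T → StrictMonoOn (g T) (Icc 0 1)
  deriv_pos : ∀ T, 0 < T → ∀ x ∈ Icc (0 : ℝ) 1, 0 < derivWithin (g T) (Icc 0 1) x
  tendsto_lipMin : Tendsto (fun T => lipMin (g T)) (𝓝[>] 0) atTop
  tendsto_lipMax : Tendsto (fun T => lipMax (g T)) atTop (𝓝 0)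

variable {n : ℕ}

/-- The transition matrix `M_T(x)`, for the weight function `g = g_T`. -/
def transitionMatrix (C : Matrix (Fin n) (Fin n) ℝ) (g : ℝ → ℝ) (x : Fin n → ℝ) :
    Matrix (Fin n) (Fin n) ℝ :=
  Matrix.of fun i j => C i j * g (x j) / ∑ k, C i k * g (x k)

/-- The stochastic row vector `u` is an invariant measure of `A`: `u A = u`. -/
def IsInvariantMeasure (A : Matrix (Fin n) (Fin n) ℝ) (u : Fin n → ℝ) : Prop :=
  u ∈ stdSimplex ℝ (Fin n) ∧ Matrix.vecMul u A = u

open Classical in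
/-- The unique invariant measure of `A`. If `A` does not have exactly one invariant measure,
the value is the zero vector, which is not a stochastic vector. -/
def invariantMeasure (A : Matrix (Fin n) (Fin n) ℝ) : Fin n → ℝ :=
  if h : ∃! u, IsInvariantMeasure A u then h.choose else 0

/-- The map `u_T`, for the weight function `g = g_T`: it sends `x` to the unique invariant
measure of `M_T(x)`. -/
def uMap (C : Matrix (Fin n) (Fin n) ℝ) (g : ℝ → ℝ) (x : Fin n → ℝ) : Fin n → ℝ :=
  invariantMeasure (transitionMatrix C g x)

/-- The set `Σ_ε` of the stochastic vectors whose first entry is at least `1 - ε`. -/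
def simplexNear (n : ℕ) [NeZero n] (ε : ℝ) : Set (Fin n → ℝ) :=
  {x | x ∈ stdSimplex ℝ (Fin n) ∧ 1 - ε ≤ x 0}

end

/-!
The map `u_T` is continuous on the simplex `Σ`, so by Brouwer's theorem it suffices that it maps
the compact convex set `Σ_ε` into itself when `T` is small.

*Brouwer's theorem* (`exists_isFixedPt_of_isCompact_of_convex`) is proved analytically. A
continuously differentiable self-map of a ball without fixed points would give a continuously
differentiable retraction `id + φ` of the ball onto its sphere. For small `t` the map `id + t φ`
permutes the ball, so `∫ det (1 + t Dφ)` is the volume of the ball; the integral is polynomial in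
`t`, so this persists at `t = 1` (`integral_det_one_add_fderiv`), where however the determinant
vanishes identically. Smooth approximation and the nearest-point projection give the general case.

*Invariant measures.* An irreducible stochastic matrix has exactly one invariant measure
(`existsUnique_isInvariantMeasure`), and uniqueness with compactness makes `u_T` continuous
(`continuousOn_uMap`).

*Invariance of `Σ_ε`.* Let `x ∈ Σ_ε`, `a = g_T ε`, `b = g_T (1 - ε)`, and let `u` be invariant for
`M_T(x)`. Every other state that can move to the first state in one step does so with probability
bounded below, and the first state is left with probability `O(a / b)`; balancing the two flows
gives such states mass `O(a / b)`. A state that cannot move there in one step has a row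
normalization `O(a)`, so its mass is `O(a)` times that of any successor. Following a path to the
first state, all other states have mass `O(a ^ (n - 1) / b)` (`exists_one_sub_apply_zero_le`), and
`O(a / b)` if the first column is positive (`exists_one_sub_apply_zero_le_of_forall_pos`). As the
logarithmic derivative of `g_T` tends to infinity uniformly, `g_T s / g_T t → 0` for `s < t`
(`IsWeightFamily.eventually_mul_le`). With `s = ε` and `t = 1 - ε` this makes `a / b` small, and
with `s = ε` and `t = ε_n` it makes `a ^ (n - 1)` small against
`g_T ε_n ^ (n - 1) ≤ g_T (1 - ε_n) ≤ b`.
-/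

/-! ### Brouwer's fixed point theorem -/

section Brouwer

open MeasureTheory Metric

variable {E : Type*} [NormedAddCommGroup E] [InnerProductSpace ℝ E] [FiniteDimensional ℝ E]

/-- The nearest-point projection onto a closed convex set. -/
theorem exists_lipschitz_retraction {K : Set E} (hne : K.Nonempty) (hcl : IsClosed K)
    (hconv : Convex ℝ K) :
    ∃ P : E → E, (∀ x, P x ∈ K) ∧ (∀ x ∈ K, P x = x) ∧
      (∀ x, P x ∈ interior K → P x = x) ∧ LipschitzWith 1 P := by
  have hex : ∀ u : E, ∃ v ∈ K, ∀ w ∈ K, inner ℝ (u - v) (w - v) ≤ 0 := fun u ↦ by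
    obtain ⟨v, hv, h⟩ := exists_norm_eq_iInf_of_complete_convex hne hcl.isComplete hconv u
    exact ⟨v, hv, (norm_eq_iInf_iff_real_inner_le_zero hconv hv).1 h⟩
  choose P hPK hP using hex
  refine ⟨P, hPK, fun x hx ↦ ?_, fun x hx ↦ ?_, LipschitzWith.of_dist_le_mul fun x y ↦ ?_⟩
  · have h := hP x x hx
    rw [real_inner_self_eq_norm_sq] at h
    have h0 : ‖x - P x‖ = 0 := by nlinarith [norm_nonneg (x - P x)]
    exact (sub_eq_zero.1 (norm_eq_zero.1 h0)).symm
  · have hlim : Tendsto (fun s : ℝ ↦ P x + s • (x - P x)) (𝓝[>] 0) (𝓝 (P x)) := by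
      have : ContinuousAt (fun s : ℝ ↦ P x + s • (x - P x)) 0 := by fun_prop
      simpa using this.tendsto.mono_left nhdsWithin_le_nhds
    obtain ⟨s, hsK, hs⟩ := ((hlim.eventually (mem_interior_iff_mem_nhds.1 hx)).and
      self_mem_nhdsWithin).exists
    have h := hP x _ hsK
    rw [add_sub_cancel_left, real_inner_smul_right, real_inner_self_eq_norm_sq] at h
    have h1 : ‖x - P x‖ ^ 2 ≤ 0 := nonpos_of_mul_nonpos_right h hs
    have h0 : ‖x - P x‖ = 0 := by nlinarith [norm_nonneg (x - P x)]
    exact (sub_eq_zero.1 (norm_eq_zero.1 h0)).symm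
  · have h1 := hP x (P y) (hPK y)
    have h2 := hP y (P x) (hPK x)
    have h3 : inner ℝ (x - P x) (P y - P x) + inner ℝ (y - P y) (P x - P y)
        = ‖P x - P y‖ ^ 2 - inner ℝ (x - y) (P x - P y) := by
      rw [← real_inner_self_eq_norm_sq]
      simp only [inner_sub_left, inner_sub_right]
      ring
    have h4 := real_inner_le_norm (x - y) (P x - P y)
    rw [NNReal.coe_one, one_mul, dist_eq_norm, dist_eq_norm]
    by_contra! h5
    nlinarith [norm_nonneg (x - y), norm_nonneg (P x - P y)]

/-- As `t ↦ det (1 + t A)` is a polynomial of degree at most `finrank ℝ E`, Lagrange interpolation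
expresses its value at `1` by its values at `finrank ℝ E + 1` nodes, with weights that do not
depend on `A`. -/
theorem det_one_add_eq_sum_lagrange (v : Fin (Module.finrank ℝ E + 1) → ℝ)
    (hv : Function.Injective v) (A : E →L[ℝ] E) :
    (1 + A).det = ∑ i, (1 + v i • A).det * (Lagrange.basis Finset.univ v i).eval 1 := by
  classical
  set b := Module.finBasis ℝ E
  set M := LinearMap.toMatrix b b (A : E →ₗ[ℝ] E) with hM
  set p : Polynomial ℝ := ((Polynomial.X : Polynomial ℝ) • M.map Polynomial.C +
    (1 : Matrix (Fin (Module.finrank ℝ E)) (Fin (Module.finrank ℝ E)) ℝ).map Polynomial.C).det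
    with hp
  have heval : ∀ t : ℝ, p.eval t = (1 + t • A).det := fun t ↦ by
    have h1 : (1 + t • A).det = (1 + t • M).det := by
      rw [ContinuousLinearMap.det, ← LinearMap.det_toMatrix b]
      congr 1
      simp [hM, LinearMap.toMatrix_one]
    rw [h1, hp, ← Polynomial.coe_evalRingHom t, RingHom.map_det]
    congr 1
    ext i j
    simp [Matrix.one_apply, add_comm]
    split_ifs <;> simp [mul_comm]
  have hdeg : p.degree < (Finset.univ : Finset (Fin (Module.finrank ℝ E + 1))).card := by
    refine lt_of_le_of_lt Polynomial.degree_le_natDegree ?_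
    have := Polynomial.natDegree_det_X_add_C_le M 1
    simp only [Fintype.card_fin, Finset.card_univ] at this ⊢
    exact_mod_cast Nat.lt_succ_of_le this
  have h := Lagrange.eq_interpolate (v := v) hv.injOn hdeg
  have h1 := heval 1
  rw [one_smul] at h1
  rw [← h1, h, Lagrange.interpolate_apply, Polynomial.eval_finsetSum]
  simp [heval]

section Volume

variable [MeasurableSpace E] [BorelSpace E]

/-- For small `t` the map `x ↦ x + t φ x` permutes the open ball, because `φ` is Lipschitz and
vanishes on the sphere; hence the change of variables formula applies. -/
theorem eventually_integral_det_one_add_smul {R : ℝ} (hR : 0 ≤ R) {U : Set E} (hU : IsOpen U)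
    (hUR : closedBall 0 R ⊆ U) {φ : E → E} (hφ : ContDiffOn ℝ 1 φ U)
    (h0 : ∀ x ∈ sphere (0 : E) R, φ x = 0) :
    ∀ᶠ t in 𝓝[>] (0 : ℝ), ∫ x in ball (0 : E) R, (1 + t • fderiv ℝ φ x).det
      = (volume : Measure E).real (ball 0 R) := by
  obtain ⟨K, hK⟩ := (hφ.mono hUR).exists_lipschitzOnWith one_ne_zero (convex_closedBall 0 R)
    (isCompact_closedBall 0 R)
  obtain ⟨P, hPmem, hPid, hPint, hPlip⟩ := exists_lipschitz_retraction
    (nonempty_closedBall.2 hR) isClosed_closedBall (convex_closedBall (0 : E) R)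
  -- the extension of `φ` by zero
  set Φ : E → E := fun x ↦ φ (P x) with hΦ
  have hΦlip : LipschitzWith K Φ := by
    have := hK.comp (hPlip.lipschitzOnWith (s := univ)) (fun x _ ↦ hPmem x)
    rw [mul_one] at this
    exact lipschitzOnWith_univ.1 this
  have hΦin : ∀ x ∈ ball (0 : E) R, Φ x = φ x := fun x hx ↦ by
    simp [hΦ, hPid x (ball_subset_closedBall hx)]
  have hΦout : ∀ x, x ∉ ball (0 : E) R → Φ x = 0 := fun x hx ↦ by
    apply h0
    by_contra hcon
    have hlt : P x ∈ ball (0 : E) R := by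
      have := hPmem x
      simp only [mem_closedBall, mem_sphere, mem_ball] at *
      exact lt_of_le_of_ne this hcon
    exact hx (hPint x (ball_subset_interior_closedBall hlt) ▸ hlt)
  have hdetpos : ∀ᶠ B in 𝓝 (1 : E →L[ℝ] E), 0 < B.det := by
    refine (ContinuousLinearMap.continuous_det.tendsto (1 : E →L[ℝ] E)).eventually_const_lt ?_
    simp [ContinuousLinearMap.det]
  obtain ⟨δ, hδ, hδdet⟩ := Metric.eventually_nhds_iff.1 hdetpos
  have hsmall : ∀ᶠ t in 𝓝[>] (0 : ℝ), t * K < min 1 δ := by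
    have : ContinuousAt (fun t : ℝ ↦ t * K) 0 := by fun_prop
    refine (this.tendsto.mono_left nhdsWithin_le_nhds).eventually_lt_const ?_
    simpa using hδ
  filter_upwards [hsmall, self_mem_nhdsWithin] with t htK ht
  have ht : 0 < t := ht
  have htnorm : ‖t‖ = t := abs_of_pos ht
  set f : E → E := fun x ↦ x + t • Φ x with hf
  have hfout : ∀ x, x ∉ ball (0 : E) R → f x = x := fun x hx ↦ by simp [hf, hΦout x hx]
  have hcontr : ∀ y : E, ContractingWith (‖t‖₊ * K) (fun x ↦ y - t • Φ x) := fun y ↦ by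
    refine ⟨?_, ?_⟩
    · rw [← NNReal.coe_lt_coe]
      push_cast
      rw [htnorm]
      exact htK.trans_le (min_le_left _ _)
    · refine LipschitzWith.of_dist_le_mul fun a b ↦ ?_
      rw [dist_sub_left, dist_smul₀]
      push_cast
      rw [mul_assoc]
      exact mul_le_mul_of_nonneg_left (hΦlip.dist_le_mul a b) (norm_nonneg _)
  have hfix : ∀ x y : E, f x = y ↔ Function.IsFixedPt (fun x ↦ y - t • Φ x) x := fun x y ↦ by
    rw [Function.IsFixedPt, sub_eq_iff_eq_add, eq_comm]
  have hinj : Function.Injective f := fun x x' h ↦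
    (hcontr (f x')).fixedPoint_unique' ((hfix _ _).1 h) ((hfix _ _).1 rfl)
  have himage : f '' ball 0 R = ball 0 R := by
    ext y
    constructor
    · rintro ⟨x, hx, rfl⟩
      by_contra hcon
      exact hcon ((hinj (hfout _ hcon)).symm ▸ hx)
    · intro hy
      have hx := (hfix _ y).2 (hcontr y).fixedPoint_isFixedPt
      refine ⟨_, ?_, hx⟩
      by_contra hcon
      rw [hfout _ hcon] at hx
      exact hcon (hx.symm ▸ hy)
  have hderiv : ∀ x ∈ ball (0 : E) R,
      HasFDerivWithinAt f (1 + t • fderiv ℝ φ x) (ball 0 R) x := fun x hx ↦ by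
    have hd : DifferentiableAt ℝ φ x :=
      (hφ.contDiffAt (hU.mem_nhds (hUR (ball_subset_closedBall hx)))).differentiableAt one_ne_zero
    have h1 : HasFDerivAt (fun x ↦ x + t • φ x) (1 + t • fderiv ℝ φ x) x :=
      (hasFDerivAt_id x).add (hd.hasFDerivAt.const_smul t)
    exact h1.hasFDerivWithinAt.congr (fun z hz ↦ by simp [hf, hΦin z hz]) (by simp [hf, hΦin x hx])
  have hpos : ∀ x ∈ ball (0 : E) R, 0 < (1 + t • fderiv ℝ φ x).det := fun x hx ↦ by
    apply hδdet
    rw [dist_eq_norm, add_sub_cancel_left, norm_smul, htnorm]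
    have := norm_fderiv_le_of_lipschitzOn ℝ (isOpen_ball.mem_nhds hx)
      (hK.mono ball_subset_closedBall)
    calc t * ‖fderiv ℝ φ x‖ ≤ t * K := by gcongr
      _ < δ := htK.trans_le (min_le_right _ _)
  have hcov := integral_image_eq_integral_abs_det_fderiv_smul (volume : Measure E)
    measurableSet_ball hderiv hinj.injOn (fun _ ↦ (1 : ℝ))
  rw [himage] at hcov
  simp only [smul_eq_mul, mul_one] at hcov
  rw [setIntegral_const, smul_eq_mul, mul_one] at hcov
  rw [hcov]
  exact setIntegral_congr_fun measurableSet_ball fun x hx ↦ (abs_of_pos (hpos x hx)).symm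

/-- The case `t = 1` of `eventually_integral_det_one_add_smul`, to which the small values of `t`
extend because both sides are polynomial in `t`. -/
theorem integral_det_one_add_fderiv {R : ℝ} (hR : 0 ≤ R) {U : Set E} (hU : IsOpen U)
    (hUR : closedBall 0 R ⊆ U) {φ : E → E} (hφ : ContDiffOn ℝ 1 φ U)
    (h0 : ∀ x ∈ sphere (0 : E) R, φ x = 0) :
    ∫ x in ball (0 : E) R, (1 + fderiv ℝ φ x).det = (volume : Measure E).real (ball 0 R) := by
  obtain ⟨δ, hδ, hδt⟩ := mem_nhdsGT_iff_exists_Ioo_subset.1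
    (eventually_integral_det_one_add_smul hR hU hUR hφ h0)
  have hδ : 0 < δ := hδ
  set v : Fin (Module.finrank ℝ E + 1) → ℝ := fun i ↦ δ / (i + 2) with hv
  have hvinj : Function.Injective v := fun i j hij ↦ by
    simp only [hv] at hij
    rw [div_eq_div_iff (by positivity) (by positivity)] at hij
    have := mul_left_cancel₀ hδ.ne' hij
    exact Fin.ext (by exact_mod_cast (add_right_cancel this).symm)
  have hvmem : ∀ i, v i ∈ Ioo 0 δ := fun i ↦
    ⟨by positivity, div_lt_self hδ (by linarith [(i : ℕ).cast_nonneg (α := ℝ)])⟩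
  have hcont : ∀ t : ℝ, ContinuousOn (fun x ↦ (1 + t • fderiv ℝ φ x).det) (closedBall 0 R) :=
    fun t ↦ by
      have h1 : ContinuousOn (fderiv ℝ φ) (closedBall 0 R) :=
        (hφ.continuousOn_fderiv_of_isOpen hU le_rfl).mono hUR
      exact ContinuousLinearMap.continuous_det.comp_continuousOn
        (continuousOn_const.add (h1.const_smul t))
  have hint : ∀ t : ℝ, IntegrableOn (fun x ↦ (1 + t • fderiv ℝ φ x).det) (ball 0 R) volume :=
    fun t ↦ ((hcont t).integrableOn_compact (isCompact_closedBall 0 R)).mono_set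
      ball_subset_closedBall
  calc ∫ x in ball (0 : E) R, (1 + fderiv ℝ φ x).det
      = ∫ x in ball (0 : E) R, ∑ i, (1 + v i • fderiv ℝ φ x).det *
          (Lagrange.basis Finset.univ v i).eval 1 := by
        simp_rw [← det_one_add_eq_sum_lagrange v hvinj]
    _ = ∑ i, (volume : Measure E).real (ball 0 R) *
          (Lagrange.basis Finset.univ v i).eval 1 := by
        rw [integral_finsetSum _ fun i _ ↦ (hint (v i)).mul_const _]
        refine Finset.sum_congr rfl fun i _ ↦ ?_
        rw [integral_mul_const, hδt (hvmem i)]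
    _ = (volume : Measure E).real (ball 0 R) := by
        rw [← Finset.mul_sum, ← Polynomial.eval_finsetSum,
          Lagrange.sum_basis hvinj.injOn Finset.univ_nonempty, Polynomial.eval_one, mul_one]

/-- Brouwer's theorem for a continuously differentiable map of a ball. Without a fixed point, the
ray from `f x` through `x` meets the sphere in a point `x + τ x • (x - f x)`, which gives a
retraction of the ball onto the sphere: its Jacobian vanishes, against
`integral_det_one_add_fderiv`. -/
theorem exists_isFixedPt_closedBall_of_contDiff {R : ℝ} (hR : 0 < R) {f : E → E}
    (hf : ContDiff ℝ 1 f) (hfR : MapsTo f (closedBall 0 R) (closedBall 0 R)) :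
    ∃ x ∈ closedBall (0 : E) R, Function.IsFixedPt f x := by
  by_contra! hno
  set w : E → E := fun x ↦ x - f x with hw
  set b : E → ℝ := fun x ↦ inner ℝ x (w x) with hb
  set D : E → ℝ := fun x ↦ b x ^ 2 + ‖w x‖ ^ 2 * (R ^ 2 - ‖x‖ ^ 2) with hD
  set τ : E → ℝ := fun x ↦ (-b x + √(D x)) / ‖w x‖ ^ 2 with hτ
  have hwc : ContDiff ℝ 1 w := contDiff_id.sub hf
  have hbc : ContDiff ℝ 1 b := contDiff_id.inner ℝ hwc
  have hDc : ContDiff ℝ 1 D :=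
    (hbc.pow 2).add ((hwc.norm_sq ℝ).mul (contDiff_const.sub (contDiff_id.norm_sq ℝ)))
  set U : Set E := {x | w x ≠ 0} ∩ {x | 0 < D x} with hUdef
  have hU : IsOpen U := (isOpen_ne_fun hwc.continuous continuous_const).inter
    (isOpen_lt continuous_const hDc.continuous)
  have hτc : ContDiffOn ℝ 1 τ U := by
    refine ContDiffOn.div (hbc.neg.contDiffOn.add (hDc.contDiffOn.sqrt fun x hx ↦ hx.2.ne'))
      (hwc.norm_sq ℝ).contDiffOn fun x hx ↦ ?_
    have := norm_pos_iff.2 hx.1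
    positivity
  have hw0 : ∀ x ∈ closedBall (0 : E) R, 0 < ‖w x‖ := fun x hx ↦
    norm_pos_iff.2 fun h ↦ hno x hx (sub_eq_zero.1 h).symm
  have hbpos : ∀ x ∈ sphere (0 : E) R, 0 < b x := fun x hx ↦ by
    have h1 := hw0 x (sphere_subset_closedBall hx)
    have h2 := mem_closedBall_zero_iff.1 (hfR (sphere_subset_closedBall hx))
    have h3 := mem_sphere_zero_iff_norm.1 hx
    have h4 : ‖f x‖ ^ 2 = ‖x‖ ^ 2 - 2 * b x + ‖w x‖ ^ 2 := by
      rw [hb, ← norm_sub_sq_real]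
      simp [hw]
    nlinarith [norm_nonneg (f x)]
  have hUR : closedBall 0 R ⊆ U := fun x hx ↦ by
    refine ⟨norm_pos_iff.1 (hw0 x hx), ?_⟩
    have h1 := hw0 x hx
    rcases (mem_closedBall_zero_iff.1 hx).lt_or_eq with h2 | h2
    · have h3 : 0 < R ^ 2 - ‖x‖ ^ 2 := by nlinarith [norm_nonneg x]
      change 0 < b x ^ 2 + ‖w x‖ ^ 2 * (R ^ 2 - ‖x‖ ^ 2)
      positivity
    · have h3 := hbpos x (mem_sphere_zero_iff_norm.2 h2)
      simp only [hD, mem_ofPred_eq, h2, sub_self, mul_zero, add_zero]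
      positivity
  have hφ0 : ∀ x ∈ sphere (0 : E) R, τ x • w x = 0 := fun x hx ↦ by
    have h1 := hbpos x hx
    have h2 : D x = b x ^ 2 := by simp [hD, mem_sphere_zero_iff_norm.1 hx]
    simp [hτ, h2, Real.sqrt_sq h1.le]
  have hφc : ContDiffOn ℝ 1 (fun x ↦ τ x • w x) U := hτc.smul hwc.contDiffOn
  have hnorm : ∀ x ∈ U, ‖x + τ x • w x‖ ^ 2 = R ^ 2 := fun x hx ↦ by
    have h1 : 0 < ‖w x‖ := norm_pos_iff.2 hx.1
    have h2 : τ x * ‖w x‖ ^ 2 = -b x + √(D x) := div_mul_cancel₀ _ (by positivity)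
    have h3 := Real.sq_sqrt hx.2.le
    rw [norm_add_sq_real, real_inner_smul_right, norm_smul, mul_pow, Real.norm_eq_abs, sq_abs]
    have h4 : ‖w x‖ ^ 2 * (‖x‖ ^ 2 + 2 * (τ x * b x) + τ x ^ 2 * ‖w x‖ ^ 2) =
        ‖w x‖ ^ 2 * R ^ 2 := by
      have h5 : √(D x) = τ x * ‖w x‖ ^ 2 + b x := by linarith
      rw [h5] at h3
      simp only [hD] at h3
      nlinarith
    exact mul_left_cancel₀ (by positivity) h4
  have hdet : ∀ x ∈ ball (0 : E) R, (1 + fderiv ℝ (fun x ↦ τ x • w x) x).det = 0 := fun x hx ↦ by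
    have hxU := hUR (ball_subset_closedBall hx)
    have hd : HasFDerivAt (fun x ↦ x + τ x • w x) (1 + fderiv ℝ (fun x ↦ τ x • w x) x) x :=
      (hasFDerivAt_id x).add (((hφc.contDiffAt (hU.mem_nhds hxU)).differentiableAt
        one_ne_zero).hasFDerivAt)
    have hconst : HasFDerivAt (fun x ↦ ‖x + τ x • w x‖ ^ 2) (0 : E →L[ℝ] ℝ) x :=
      (hasFDerivAt_const (R ^ 2) x).congr_of_eventuallyEq
        (Filter.eventually_of_mem (hU.mem_nhds hxU) hnorm)
    have horth := hd.norm_sq.unique hconst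
    by_contra hne
    set A := 1 + fderiv ℝ (fun x ↦ τ x • w x) x with hA
    obtain ⟨z, hz⟩ := (LinearMap.equivOfDetNeZero (A : E →ₗ[ℝ] E) hne).surjective (x + τ x • w x)
    have hz' : A z = x + τ x • w x := hz
    have h1 := congrArg (fun B : E →L[ℝ] ℝ ↦ B z) horth
    simp only [smul_apply, ContinuousLinearMap.comp_apply, hz', coe_innerSL_apply,
      real_inner_self_eq_norm_sq, zero_apply, hnorm x hxU] at h1
    simp [hR.ne'] at h1
  have h1 := integral_det_one_add_fderiv hR.le hU hUR hφc hφ0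
  rw [setIntegral_congr_fun measurableSet_ball hdet, integral_zero] at h1
  have h2 : 0 < (volume : Measure E).real (ball 0 R) :=
    ENNReal.toReal_pos (measure_ball_pos _ _ hR).ne' measure_ball_lt_top.ne
  exact h2.ne h1

end Volume

/-- Brouwer's theorem in a Euclidean space: compose the map with the nearest-point projection,
and approximate the result uniformly by smooth maps of a large ball. -/
theorem exists_isFixedPt_of_innerProductSpace {K : Set E} (hK : IsCompact K) (hconv : Convex ℝ K)
    (hne : K.Nonempty) {F : E → E} (hF : ContinuousOn F K) (hmaps : MapsTo F K K) :
    ∃ x ∈ K, Function.IsFixedPt F x := by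
  borelize E
  obtain ⟨P, hPmem, hPid, -, hPlip⟩ := exists_lipschitz_retraction hne hK.isClosed hconv
  have hfc : Continuous fun x ↦ F (P x) := hF.comp_continuous hPlip.continuous hPmem
  obtain ⟨r, hr⟩ := hK.isBounded.exists_norm_le
  set R := |r| + 1 with hRdef
  have hR : 0 < R := by positivity
  obtain ⟨x, hx, hmin⟩ := (isCompact_closedBall (0 : E) R).exists_isMinOn
    (nonempty_closedBall.2 hR.le) (f := fun x ↦ dist x (F (P x)))
    (continuous_id.dist hfc).continuousOn
  have hx0 : dist x (F (P x)) = 0 := by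
    by_contra hpos
    have hpos : 0 < dist x (F (P x)) := lt_of_le_of_ne dist_nonneg (Ne.symm hpos)
    obtain ⟨h, hhc, happ, -⟩ := hfc.exists_contDiff_approx 1
      (ε := fun _ ↦ min 1 (dist x (F (P x)))) continuous_const
      (fun _ ↦ lt_min one_pos hpos)
    obtain ⟨y, hy, hfix⟩ := exists_isFixedPt_closedBall_of_contDiff hR hhc fun y _ ↦ by
      rw [mem_closedBall_zero_iff]
      have h1 := hr _ (hmaps (hPmem y))
      have h2 := (happ y).trans_le (min_le_left _ _)
      rw [dist_eq_norm] at h2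
      have h3 := norm_le_norm_add_norm_sub' (h y) (F (P y))
      linarith [le_abs_self r]
    have h1 := (happ y).trans_le (min_le_right _ _)
    rw [hfix.eq] at h1
    exact (hmin hy).not_gt h1
  have hxF : F (P x) = x := (dist_eq_zero.1 hx0).symm
  have hxK : x ∈ K := hxF ▸ hmaps (hPmem x)
  exact ⟨x, hxK, by rw [Function.IsFixedPt, ← hPid x hxK, hxF, hPid x hxK]⟩

end Brouwer

/-- **Brouwer's fixed point theorem** for compact convex sets in finite dimension. -/
theorem exists_isFixedPt_of_isCompact_of_convex {V : Type*} [NormedAddCommGroup V]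
    [NormedSpace ℝ V] [FiniteDimensional ℝ V] {K : Set V} (hK : IsCompact K) (hconv : Convex ℝ K)
    (hne : K.Nonempty) {F : V → V} (hF : ContinuousOn F K) (hmaps : MapsTo F K K) :
    ∃ x ∈ K, Function.IsFixedPt F x := by
  set e := toEuclidean (E := V) with he
  obtain ⟨_, ⟨x, hx, rfl⟩, hfix⟩ := exists_isFixedPt_of_innerProductSpace
    (K := e '' K) (F := fun y ↦ e (F (e.symm y))) (hK.image e.continuous)
    (hconv.linear_image e.toLinearEquiv.toLinearMap) (hne.image e)
    (e.continuous.comp_continuousOn (hF.comp e.symm.continuous.continuousOn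
      (by rintro _ ⟨x, hx, rfl⟩; simpa using hx)))
    (by rintro _ ⟨x, hx, rfl⟩; exact mem_image_of_mem e (by simpa using hmaps hx))
  exact ⟨x, hx, e.injective (by simpa [Function.IsFixedPt] using hfix)⟩

/-! ### Invariant measures of irreducible stochastic matrices -/

section Markov

/-- In a strongly connected graph some edge enters any given proper nonempty set of vertices. -/
theorem Matrix.IsIrreducible.exists_pos_of_notMem_of_mem {ι : Type*} {A : Matrix ι ι ℝ}
    (hA : A.IsIrreducible) {S : Set ι} {i j : ι} (hi : i ∉ S) (hj : j ∈ S) :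
    ∃ k ∉ S, ∃ l ∈ S, 0 < A k l := by
  by_contra! h
  let : Quiver ι := A.toQuiver
  obtain ⟨p, -⟩ := hA.connected i j
  have key : ∀ {l : ι}, Quiver.Path i l → l ∉ S := fun p ↦ by
    induction p with
    | nil => exact hi
    | cons q e ih => exact fun hl ↦ (h _ ih _ hl).not_gt e.down
  exact key p hj

/-- Irreducibility depends only on which entries are positive. -/
theorem Matrix.IsIrreducible.of_pos_iff {ι : Type*} {A B : Matrix ι ι ℝ} (hA : A.IsIrreducible)
    (hB : ∀ i j, 0 ≤ B i j) (h : ∀ i j, 0 < B i j ↔ 0 < A i j) : B.IsIrreducible := by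
  have hq : B.toQuiver = A.toQuiver := by
    unfold Matrix.toQuiver
    congr
    funext i j
    rw [propext (h i j)]
  exact ⟨hB, hq ▸ hA.connected⟩

variable {n : ℕ}

theorem eq_zero_of_vecMul_eq_self {M : Matrix (Fin n) (Fin n) ℝ} (hM : M.IsIrreducible)
    {u : Fin n → ℝ} (hu : ∀ i, 0 ≤ u i) (huM : Matrix.vecMul u M = u) {i : Fin n}
    (hi : u i = 0) : u = 0 := by
  by_contra hne
  obtain ⟨j, hj⟩ := Function.ne_iff.1 hne
  obtain ⟨k, hk, l, hl, hkl⟩ := hM.exists_pos_of_notMem_of_mem (S := {i | u i = 0}) hj hi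
  have h1 : ∑ i, u i * M i l = 0 := (congrFun huM l).trans hl
  have h2 := (Finset.sum_eq_zero_iff_of_nonneg fun i _ ↦ mul_nonneg (hu i) (hM.nonneg i l)).1 h1 k
    (Finset.mem_univ k)
  exact (mul_ne_zero hk hkl.ne') h2

theorem IsInvariantMeasure.pos {M : Matrix (Fin n) (Fin n) ℝ} (hM : M.IsIrreducible)
    {u : Fin n → ℝ} (hu : IsInvariantMeasure M u) (i : Fin n) : 0 < u i := by
  refine lt_of_le_of_ne (hu.1.1 i) fun h ↦ ?_
  have h1 := hu.1.2
  rw [eq_zero_of_vecMul_eq_self hM hu.1.1 hu.2 h.symm] at h1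
  simp at h1

theorem IsInvariantMeasure.unique {M : Matrix (Fin n) (Fin n) ℝ} (hM : M.IsIrreducible)
    {u w : Fin n → ℝ} (hu : IsInvariantMeasure M u) (hw : IsInvariantMeasure M w) : u = w := by
  rcases isEmpty_or_nonempty (Fin n) with _ | _
  · exact Subsingleton.elim _ _
  -- subtract from `u` the largest multiple of `w` that leaves a nonnegative vector
  obtain ⟨i, -, hi⟩ := Finset.exists_min_image Finset.univ (fun i ↦ u i / w i)
    Finset.univ_nonempty
  set t := u i / w i with ht
  have hwpos := hw.pos hM
  have h0 : u - t • w = 0 := by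
    refine eq_zero_of_vecMul_eq_self hM (i := i) (fun j ↦ ?_) ?_ ?_
    · have := (le_div_iff₀ (hwpos j)).1 (hi j (Finset.mem_univ j))
      simpa using this
    · rw [Matrix.sub_vecMul, Matrix.smul_vecMul, hu.2, hw.2]
    · simp [ht, div_mul_cancel₀ _ (hwpos i).ne']
  have h1 : u = t • w := sub_eq_zero.1 h0
  have h2 := hu.1.2
  rw [h1] at h2
  simp only [Pi.smul_apply, smul_eq_mul, ← Finset.mul_sum, hw.1.2, mul_one] at h2
  rw [h1, h2, one_smul]

/-- Existence is Brouwer's theorem for `u ↦ u M`. -/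
theorem existsUnique_isInvariantMeasure [NeZero n] {M : Matrix (Fin n) (Fin n) ℝ}
    (hM : M.IsIrreducible) (hsum : ∀ i, ∑ j, M i j = 1) : ∃! u, IsInvariantMeasure M u := by
  obtain ⟨u, hu, hfix⟩ := exists_isFixedPt_of_isCompact_of_convex
    (isCompact_stdSimplex ℝ (Fin n)) (convex_stdSimplex ℝ (Fin n))
    ⟨_, single_mem_stdSimplex ℝ (0 : Fin n)⟩ (F := fun u ↦ Matrix.vecMul u M)
    (Continuous.continuousOn (by fun_prop)) (fun u hu ↦ by
      refine ⟨fun j ↦ Finset.sum_nonneg (s := Finset.univ) (f := fun i ↦ u i * M i j)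
        fun i _ ↦ mul_nonneg (hu.1 i) (hM.nonneg i j), ?_⟩
      change ∑ j, ∑ i, u i * M i j = 1
      rw [Finset.sum_comm]
      simp [← Finset.mul_sum, hsum, hu.2])
  exact ⟨u, ⟨hu, hfix⟩, fun w hw ↦ hw.unique hM ⟨hu, hfix⟩⟩

theorem isInvariantMeasure_invariantMeasure {A : Matrix (Fin n) (Fin n) ℝ}
    (h : ∃! u, IsInvariantMeasure A u) : IsInvariantMeasure A (invariantMeasure A) := by
  rw [invariantMeasure, dif_pos h]
  exact h.choose_spec.1

end Markov

/-! ### Continuity of the map `u_T` -/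

section Transition

variable {n : ℕ} [NeZero n] {C : Matrix (Fin n) (Fin n) ℝ} {g : ℝ → ℝ} {x : Fin n → ℝ}

theorem Matrix.IsIrreducible.exists_row_pos (hC : C.IsIrreducible) (h00 : 0 < C 0 0)
    (i : Fin n) : ∃ j, 0 < C i j := by
  by_cases hi : i = 0
  · exact ⟨0, hi ▸ h00⟩
  · obtain ⟨k, hk, l, -, hkl⟩ := hC.exists_pos_of_notMem_of_mem (S := {i}ᶜ) (i := i) (j := 0)
      (by simp) (by simpa using Ne.symm hi)
    exact ⟨l, by simp at hk; exact hk ▸ hkl⟩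

theorem rowSum_pos (hC : C.IsIrreducible) (h00 : 0 < C 0 0) {y : Fin n → ℝ}
    (hy : ∀ i, 0 < y i) (i : Fin n) : 0 < ∑ k, C i k * y k := by
  obtain ⟨j, hj⟩ := hC.exists_row_pos h00 i
  exact Finset.sum_pos' (fun k _ ↦ mul_nonneg (hC.nonneg i k) (hy k).le)
    ⟨j, Finset.mem_univ j, mul_pos hj (hy j)⟩

theorem sum_transitionMatrix (hC : C.IsIrreducible) (h00 : 0 < C 0 0)
    (hg : ∀ i, 0 < g (x i)) (i : Fin n) : ∑ j, transitionMatrix C g x i j = 1 := by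
  simp only [transitionMatrix, Matrix.of_apply]
  rw [← Finset.sum_div, div_self (rowSum_pos hC h00 hg i).ne']

theorem isIrreducible_transitionMatrix (hC : C.IsIrreducible) (h00 : 0 < C 0 0)
    (hg : ∀ i, 0 < g (x i)) : (transitionMatrix C g x).IsIrreducible := by
  have h := rowSum_pos hC h00 hg
  refine hC.of_pos_iff (fun i j ↦ ?_) (fun i j ↦ ?_)
  · exact div_nonneg (mul_nonneg (hC.nonneg i j) (hg j).le) (h i).le
  · simp only [transitionMatrix, Matrix.of_apply]
    rw [div_pos_iff_of_pos_right (h i), mul_pos_iff_of_pos_right (hg j)]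

theorem isInvariantMeasure_uMap (hC : C.IsIrreducible) (h00 : 0 < C 0 0)
    (hg : ∀ t ∈ Icc (0 : ℝ) 1, 0 < g t) (hx : x ∈ stdSimplex ℝ (Fin n)) :
    IsInvariantMeasure (transitionMatrix C g x) (uMap C g x) :=
  have hg' := fun i ↦ hg _ (mem_Icc_of_mem_stdSimplex hx i)
  isInvariantMeasure_invariantMeasure <| existsUnique_isInvariantMeasure
    (isIrreducible_transitionMatrix hC h00 hg') (sum_transitionMatrix hC h00 hg')

/-- The graph of `uMap C g` is cut out of a compact set by continuous equations, so it is
closed. -/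
theorem continuousOn_uMap (hC : C.IsIrreducible) (h00 : 0 < C 0 0)
    (hg : ∀ t ∈ Icc (0 : ℝ) 1, 0 < g t) (hgc : ContinuousOn g (Icc 0 1)) :
    ContinuousOn (uMap C g) (stdSimplex ℝ (Fin n)) := by
  set S := stdSimplex ℝ (Fin n) with hS
  have hgx : ∀ p ∈ S ×ˢ S, ∀ i, 0 < g (p.1 i) := fun p hp i ↦
    hg _ (mem_Icc_of_mem_stdSimplex hp.1 i)
  have hgcomp : ∀ k, ContinuousOn (fun p : (Fin n → ℝ) × (Fin n → ℝ) ↦ g (p.1 k)) (S ×ˢ S) :=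
    fun k ↦ hgc.comp (by fun_prop) fun p hp ↦ mem_Icc_of_mem_stdSimplex hp.1 k
  have hcont : ContinuousOn (fun p : (Fin n → ℝ) × (Fin n → ℝ) ↦
      Matrix.vecMul p.2 (transitionMatrix C g p.1) - p.2) (S ×ˢ S) := by
    refine ContinuousOn.sub (continuousOn_pi.2 fun j ↦ ?_) continuousOn_snd
    change ContinuousOn (fun p : (Fin n → ℝ) × (Fin n → ℝ) ↦
      ∑ i, p.2 i * (C i j * g (p.1 j) / ∑ k, C i k * g (p.1 k))) (S ×ˢ S)
    refine continuousOn_finsetSum _ fun i _ ↦ ContinuousOn.mul (by fun_prop)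
      (ContinuousOn.div (continuousOn_const.mul (hgcomp j))
        (continuousOn_finsetSum _ fun k _ ↦ continuousOn_const.mul (hgcomp k)) fun p hp ↦ ?_)
    exact (rowSum_pos hC h00 (hgx p hp) i).ne'
  have hSc : IsCompact S := isCompact_stdSimplex ℝ (Fin n)
  have hG := hcont.preimage_isClosed_of_isClosed (hSc.prod hSc).isClosed (isClosed_singleton (x := 0))
  refine continuousOn_iff_isClosed.2 fun t ht ↦ ⟨_, (((hSc.prod hSc).of_isClosed_subset
    (hG.inter (ht.preimage continuous_snd)) fun p hp ↦ hp.1.1).image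
      continuous_fst).isClosed, ?_⟩
  ext x
  constructor
  · rintro ⟨hxt, hx⟩
    have h := isInvariantMeasure_uMap hC h00 hg hx
    exact ⟨⟨(x, uMap C g x), ⟨⟨⟨hx, h.1⟩, sub_eq_zero.2 h.2⟩, hxt⟩, rfl⟩, hx⟩
  · rintro ⟨⟨⟨x, u⟩, ⟨⟨hmem, heq⟩, hut⟩, rfl⟩, hx⟩
    have hirr := isIrreducible_transitionMatrix hC h00 (hgx _ hmem)
    have h := isInvariantMeasure_uMap hC h00 hg hx
    have hu : u = uMap C g x := IsInvariantMeasure.unique hirr ⟨hmem.2, sub_eq_zero.1 heq⟩ h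
    exact ⟨by simpa [hu] using hut, hx⟩

/-- If `u_T` maps `Σ_ε` into itself, then it has a fixed point there, by Brouwer's theorem. -/
theorem exists_isFixedPt_simplexNear (hC : C.IsIrreducible) (h00 : 0 < C 0 0)
    (hg : ∀ t ∈ Icc (0 : ℝ) 1, 0 < g t) (hgc : ContinuousOn g (Icc 0 1)) {ε : ℝ} (hε : 0 ≤ ε)
    (hmaps : ∀ x ∈ simplexNear n ε, 1 - ε ≤ uMap C g x 0) :
    ∃ x ∈ simplexNear n ε, Function.IsFixedPt (uMap C g) x := by
  have hclosed : IsClosed {x : Fin n → ℝ | 1 - ε ≤ x 0} :=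
    isClosed_le continuous_const (continuous_apply 0)
  have heq : simplexNear n ε = stdSimplex ℝ (Fin n) ∩ {x | 1 - ε ≤ x 0} := rfl
  refine exists_isFixedPt_of_isCompact_of_convex ?_ ?_ ?_
    ((continuousOn_uMap hC h00 hg hgc).mono fun x hx ↦ hx.1)
    fun x hx ↦ ⟨(isInvariantMeasure_uMap hC h00 hg hx.1).1, hmaps x hx⟩
  · exact heq ▸ (isCompact_stdSimplex ℝ (Fin n)).inter_right hclosed
  · exact heq ▸ (convex_stdSimplex ℝ (Fin n)).inter
      (convex_halfSpace_ge (IsLinearMap.mk (fun _ _ ↦ rfl) fun _ _ ↦ rfl) _)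
  · exact ⟨Pi.single 0 1, single_mem_stdSimplex ℝ (0 : Fin n), by simpa using hε⟩

end Transition

/-! ### Concentration of the invariant measure on the first state -/

section Estimates

variable {n : ℕ} [NeZero n] {C : Matrix (Fin n) (Fin n) ℝ}

/-- The weights `y` have a peak at state `0`: there the weight is at least `b`, elsewhere it is
between `1` and `a`, where `1 ≤ a ≤ b`. For `y j = g (x j)` with `x ∈ Σ_ε` and `ε ≤ 1 / 2` this
holds with `a = g ε` and `b = g (1 - ε)`. -/
structure IsPeaked (a b : ℝ) (y : Fin n → ℝ) : Prop where
  one_le : 1 ≤ a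
  le : a ≤ b
  le_zero : b ≤ y 0
  one_le_apply : ∀ j, 1 ≤ y j
  apply_le : ∀ j, j ≠ 0 → y j ≤ a

theorem IsPeaked.apply_le_zero {a b : ℝ} {y : Fin n → ℝ} (h : IsPeaked a b y) (j : Fin n) :
    y j ≤ y 0 := by
  by_cases hj : j = 0
  · rw [hj]
  · exact (h.apply_le j hj).trans (h.le.trans h.le_zero)

theorem sum_row_pos (hC : C.IsIrreducible) (h00 : 0 < C 0 0) (i : Fin n) : 0 < ∑ k, C i k := by
  simpa using rowSum_pos hC h00 (y := fun _ ↦ 1) (fun _ ↦ one_pos) i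

/-- A state from which `0` is accessible in one step moves there with probability close to `1`. -/
theorem exists_one_sub_transitionMatrix_le (hC : C.IsIrreducible) (h00 : 0 < C 0 0) {i : Fin n}
    (hi : 0 < C i 0) :
    ∃ c > 0, ∀ (a b : ℝ) (g : ℝ → ℝ) (x : Fin n → ℝ), IsPeaked a b (fun j ↦ g (x j)) →
      1 - transitionMatrix C g x i 0 ≤ c * (a / b) := by
  refine ⟨(∑ k, C i k) / C i 0, div_pos (sum_row_pos hC h00 i) hi, fun a b g x hp ↦ ?_⟩
  have ha : 0 < a := one_pos.trans_le hp.one_le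
  have hb : 0 < b := ha.trans_le hp.le
  have hS := rowSum_pos hC h00 (y := fun j ↦ g (x j))
    (fun j ↦ one_pos.trans_le (hp.one_le_apply j)) i
  have h1 : ∑ k, C i k * g (x k) - C i 0 * g (x 0) ≤ (∑ k, C i k) * a := by
    rw [← Finset.add_sum_erase _ _ (Finset.mem_univ (0 : Fin n)), add_sub_cancel_left,
      Finset.sum_mul, ← Finset.add_sum_erase _ (fun k ↦ C i k * a) (Finset.mem_univ (0 : Fin n))]
    have h2 : ∑ k ∈ Finset.univ.erase 0, C i k * g (x k) ≤
        ∑ k ∈ Finset.univ.erase 0, C i k * a := Finset.sum_le_sum fun k hk ↦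
      mul_le_mul_of_nonneg_left (hp.apply_le k (Finset.ne_of_mem_erase hk)) (hC.nonneg i k)
    have h3 : 0 ≤ C i 0 * a := by positivity
    linarith
  have h4 : C i 0 * b ≤ ∑ k, C i k * g (x k) :=
    (mul_le_mul_of_nonneg_left hp.le_zero hi.le).trans
      (Finset.single_le_sum (f := fun k ↦ C i k * g (x k))
        (fun k _ ↦ mul_nonneg (hC.nonneg i k) (one_pos.trans_le (hp.one_le_apply k)).le)
        (Finset.mem_univ 0))
  calc 1 - transitionMatrix C g x i 0
      = (∑ k, C i k * g (x k) - C i 0 * g (x 0)) / ∑ k, C i k * g (x k) := by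
        rw [sub_div, div_self hS.ne']
        rfl
    _ ≤ (∑ k, C i k) * a / (C i 0 * b) := by
        have := sum_row_pos hC h00 i
        gcongr
    _ = (∑ k, C i k) / C i 0 * (a / b) := mul_div_mul_comm _ _ _ _

/-- The invariant measure balances the flow out of state `0` against the flow into it, and the
former is small. -/
theorem exists_apply_le_of_pos (hC : C.IsIrreducible) (h00 : 0 < C 0 0) {i : Fin n} (hi0 : i ≠ 0)
    (hi : 0 < C i 0) :
    ∃ c > 0, ∀ (a b : ℝ) (g : ℝ → ℝ) (x u : Fin n → ℝ), IsPeaked a b (fun j ↦ g (x j)) →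
      IsInvariantMeasure (transitionMatrix C g x) u → u i ≤ c * (a / b) * u 0 := by
  obtain ⟨c, hc, hcb⟩ := exists_one_sub_transitionMatrix_le hC h00 h00
  have hR := sum_row_pos hC h00 i
  refine ⟨(∑ k, C i k) / C i 0 * c, by positivity, fun a b g x u hp hu ↦ ?_⟩
  have hy : ∀ j, 0 < g (x j) := fun j ↦ one_pos.trans_le (hp.one_le_apply j)
  have hS := rowSum_pos hC h00 (y := fun j ↦ g (x j)) hy i
  have hM := isIrreducible_transitionMatrix hC h00 hy
  have hMi : C i 0 / ∑ k, C i k ≤ transitionMatrix C g x i 0 := by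
    change _ ≤ C i 0 * g (x 0) / ∑ k, C i k * g (x k)
    rw [div_le_div_iff₀ hR hS, mul_assoc]
    refine mul_le_mul_of_nonneg_left ?_ hi.le
    rw [mul_comm, Finset.sum_mul]
    exact Finset.sum_le_sum fun k _ ↦ mul_le_mul_of_nonneg_left (hp.apply_le_zero k) (hC.nonneg i k)
  have hflow : u i * transitionMatrix C g x i 0 ≤ u 0 * (1 - transitionMatrix C g x 0 0) := by
    have h1 : ∑ k, u k * transitionMatrix C g x k 0 = u 0 := congrFun hu.2 0
    rw [← Finset.add_sum_erase _ _ (Finset.mem_univ (0 : Fin n))] at h1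
    have h2 : u i * transitionMatrix C g x i 0 ≤
        ∑ k ∈ Finset.univ.erase 0, u k * transitionMatrix C g x k 0 := Finset.single_le_sum
      (f := fun k ↦ u k * transitionMatrix C g x k 0) (fun k _ ↦ mul_nonneg (hu.1.1 k) (hM.nonneg k 0))
      (Finset.mem_erase.2 ⟨hi0, Finset.mem_univ i⟩)
    linarith
  have h3 : u i * (C i 0 / ∑ k, C i k) ≤ u 0 * (c * (a / b)) :=
    (mul_le_mul_of_nonneg_left hMi (hu.1.1 i)).trans
      (hflow.trans (mul_le_mul_of_nonneg_left (hcb a b g x hp) (hu.1.1 0)))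
  calc u i = (∑ k, C i k) / C i 0 * (u i * (C i 0 / ∑ k, C i k)) := by field_simp
    _ ≤ (∑ k, C i k) / C i 0 * (u 0 * (c * (a / b))) := by gcongr
    _ = _ := by ring

/-- If `0` is not accessible from `i` in one step, then the normalization of row `i` is `O(a)`,
so a successor `j` of `i` receives at least a fraction of order `1 / a` of the mass of `i`. -/
theorem exists_apply_le_of_eq_zero (hC : C.IsIrreducible) (h00 : 0 < C 0 0) {i j : Fin n}
    (hi : C i 0 = 0) (hij : 0 < C i j) :
    ∃ c > 0, ∀ (a b : ℝ) (g : ℝ → ℝ) (x u : Fin n → ℝ), IsPeaked a b (fun j ↦ g (x j)) →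
      IsInvariantMeasure (transitionMatrix C g x) u → u i ≤ c * a * u j := by
  have hR := sum_row_pos hC h00 i
  refine ⟨(∑ k, C i k) / C i j, by positivity, fun a b g x u hp hu ↦ ?_⟩
  have ha : 0 < a := one_pos.trans_le hp.one_le
  have hy : ∀ j, 0 < g (x j) := fun j ↦ one_pos.trans_le (hp.one_le_apply j)
  have hS := rowSum_pos hC h00 (y := fun j ↦ g (x j)) hy i
  have hM := isIrreducible_transitionMatrix hC h00 hy
  have hMij : C i j / ((∑ k, C i k) * a) ≤ transitionMatrix C g x i j := by
    change _ ≤ C i j * g (x j) / ∑ k, C i k * g (x k)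
    refine div_le_div₀ (mul_pos hij (hy j)).le (le_mul_of_one_le_right hij.le (hp.one_le_apply j))
      hS ?_
    rw [Finset.sum_mul]
    refine Finset.sum_le_sum fun k _ ↦ ?_
    by_cases hk : k = 0
    · simp [hk, hi]
    · exact mul_le_mul_of_nonneg_left (hp.apply_le k hk) (hC.nonneg i k)
  have hflow : u i * transitionMatrix C g x i j ≤ u j := by
    have h1 : ∑ k, u k * transitionMatrix C g x k j = u j := congrFun hu.2 j
    rw [← h1]
    exact Finset.single_le_sum (f := fun k ↦ u k * transitionMatrix C g x k j)
      (fun k _ ↦ mul_nonneg (hu.1.1 k) (hM.nonneg k j)) (Finset.mem_univ i)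
  have h3 := (mul_le_mul_of_nonneg_left hMij (hu.1.1 i)).trans hflow
  calc u i = (∑ k, C i k) / C i j * a * (u i * (C i j / ((∑ k, C i k) * a))) := by field_simp
    _ ≤ (∑ k, C i k) / C i j * a * u j := by gcongr

/-- Adding one state at a time, each with an edge into the set already reached, costs at most one
factor `a` per state. -/
theorem exists_finset_apply_le (hC : C.IsIrreducible) (h00 : 0 < C 0 0) (k : ℕ) (hk : k < n) :
    ∃ A : Finset (Fin n), 0 ∈ A ∧ A.card = k + 1 ∧ ∃ c > 0,
      ∀ (a b : ℝ) (g : ℝ → ℝ) (x u : Fin n → ℝ), IsPeaked a b (fun j ↦ g (x j)) →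
        IsInvariantMeasure (transitionMatrix C g x) u →
          ∀ i ∈ A, i ≠ 0 → u i ≤ c * (a ^ k / b) * u 0 := by
  induction k with
  | zero =>
    exact ⟨{0}, by simp, by simp, 1, one_pos, fun a b g x u _ _ i hi hi0 ↦
      absurd (Finset.mem_singleton.1 hi) hi0⟩
  | succ k ih =>
    obtain ⟨A, h0A, hcard, c, hc, hA⟩ := ih (by omega)
    obtain ⟨i₀, hi₀⟩ : ∃ i, i ∉ A := by
      by_contra! h
      have := Finset.card_eq_iff_eq_univ A |>.2 (Finset.eq_univ_iff_forall.2 h)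
      simp at this
      omega
    obtain ⟨i, hi, j, hj, hij⟩ := hC.exists_pos_of_notMem_of_mem (S := (A : Set (Fin n)))
      (by simpa using hi₀) (by simpa using h0A)
    have hi : i ∉ A := by simpa using hi
    have hj : j ∈ A := by simpa using hj
    have hi0 : i ≠ 0 := fun h ↦ hi (h ▸ h0A)
    obtain ⟨d, hd, hdi⟩ : ∃ d > 0, ∀ (a b : ℝ) (g : ℝ → ℝ) (x u : Fin n → ℝ),
        IsPeaked a b (fun j ↦ g (x j)) → IsInvariantMeasure (transitionMatrix C g x) u →
          u i ≤ d * (a ^ (k + 1) / b) * u 0 := by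
      rcases (hC.nonneg i 0).eq_or_lt with h | h
      · obtain ⟨d, hd, hdi⟩ := exists_apply_le_of_eq_zero hC h00 h.symm hij
        refine ⟨d * c, by positivity, fun a b g x u hp hu ↦ ?_⟩
        have hj0 : j ≠ 0 := fun h' ↦ hij.ne (h' ▸ h)
        have ha : 0 < a := one_pos.trans_le hp.one_le
        calc u i ≤ d * a * u j := hdi a b g x u hp hu
          _ ≤ d * a * (c * (a ^ k / b) * u 0) := by
            gcongr
            exact hA a b g x u hp hu j hj hj0
          _ = _ := by ring
      · obtain ⟨d, hd, hdi⟩ := exists_apply_le_of_pos hC h00 hi0 h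
        refine ⟨d, hd, fun a b g x u hp hu ↦ (hdi a b g x u hp hu).trans ?_⟩
        have hb : 0 < b := one_pos.trans_le (hp.one_le.trans hp.le)
        have := hu.1.1 0
        gcongr
        exact le_self_pow₀ hp.one_le k.succ_ne_zero
    refine ⟨insert i A, by simp [h0A], by simp [hi, hcard], c + d, by positivity,
      fun a b g x u hp hu l hl hl0 ↦ ?_⟩
    have ha : 0 < a := one_pos.trans_le hp.one_le
    have hb : 0 < b := ha.trans_le hp.le
    have hu0 := hu.1.1 0
    rcases Finset.mem_insert.1 hl with rfl | hl
    · refine (hdi a b g x u hp hu).trans ?_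
      gcongr
      linarith
    · refine (hA a b g x u hp hu l hl hl0).trans ?_
      gcongr
      · linarith
      · exact hp.one_le
      · exact k.le_succ

theorem exists_one_sub_apply_zero_le (hC : C.IsIrreducible) (h00 : 0 < C 0 0) :
    ∃ c > 0, ∀ (a b : ℝ) (g : ℝ → ℝ) (x u : Fin n → ℝ), IsPeaked a b (fun j ↦ g (x j)) →
      IsInvariantMeasure (transitionMatrix C g x) u → 1 - u 0 ≤ c * (a ^ (n - 1) / b) := by
  have hn : 0 < n := NeZero.pos n
  obtain ⟨A, -, hcard, c, hc, hA⟩ := exists_finset_apply_le hC h00 (n - 1) (by omega)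
  have hAu : A = Finset.univ := by
    rw [← Finset.card_eq_iff_eq_univ, hcard, Fintype.card_fin]
    omega
  refine ⟨n * c, by positivity, fun a b g x u hp hu ↦ ?_⟩
  have ha : 0 < a := one_pos.trans_le hp.one_le
  have hb : 0 < b := ha.trans_le hp.le
  have h1 : u 0 + ∑ i ∈ Finset.univ.erase 0, u i = 1 := by
    rw [Finset.add_sum_erase _ _ (Finset.mem_univ _), hu.1.2]
  have h2 : ∑ i ∈ Finset.univ.erase 0, u i ≤
      ∑ _i ∈ (Finset.univ : Finset (Fin n)).erase 0, c * (a ^ (n - 1) / b) := by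
    refine Finset.sum_le_sum fun i hi ↦ ?_
    refine (hA a b g x u hp hu i (hAu ▸ Finset.mem_univ i) (Finset.ne_of_mem_erase hi)).trans ?_
    exact mul_le_of_le_one_right (by positivity) (mem_Icc_of_mem_stdSimplex hu.1 0).2
  have h3 : ∑ _i ∈ (Finset.univ : Finset (Fin n)).erase 0, c * (a ^ (n - 1) / b) ≤
      n * c * (a ^ (n - 1) / b) :=
    (Finset.sum_le_sum_of_subset_of_nonneg (Finset.subset_univ _)
      fun _ _ _ ↦ by positivity).trans_eq (by simp [mul_assoc])
  linarith

/-- When every state has an edge to `0`, the power `n - 1` of `exists_one_sub_apply_zero_le`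
improves to `1`. -/
theorem exists_one_sub_apply_zero_le_of_forall_pos (hC : C.IsIrreducible) (h0 : ∀ i, 0 < C i 0) :
    ∃ c > 0, ∀ (a b : ℝ) (g : ℝ → ℝ) (x u : Fin n → ℝ), IsPeaked a b (fun j ↦ g (x j)) →
      IsInvariantMeasure (transitionMatrix C g x) u → 1 - u 0 ≤ c * (a / b) := by
  choose c hc hcb using fun i ↦ exists_one_sub_transitionMatrix_le hC (h0 0) (h0 i)
  refine ⟨∑ i, c i, Finset.sum_pos (fun i _ ↦ hc i) Finset.univ_nonempty,
    fun a b g x u hp hu ↦ ?_⟩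
  have ha : 0 < a := one_pos.trans_le hp.one_le
  have hb : 0 < b := ha.trans_le hp.le
  have h1 : ∑ k, u k * transitionMatrix C g x k 0 = u 0 := congrFun hu.2 0
  calc 1 - u 0 = ∑ k, u k * (1 - transitionMatrix C g x k 0) := by
        simp only [mul_sub, mul_one, Finset.sum_sub_distrib, h1, hu.1.2]
    _ ≤ ∑ k, c k * (a / b) := Finset.sum_le_sum fun k _ ↦
        (mul_le_mul_of_nonneg_left (hcb k a b g x hp) (hu.1.1 k)).trans
          (mul_le_of_le_one_left (mul_nonneg (hc k).le (by positivity))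
            (mem_Icc_of_mem_stdSimplex hu.1 k).2)
    _ = (∑ i, c i) * (a / b) := by rw [Finset.sum_mul]

end Estimates

/-! ### Growth of the weight functions -/

section Weights

/-- Integrated form of the bound `lipMin g ≤ (log g)'`. -/
theorem mul_exp_lipMin_le {g : ℝ → ℝ} (hpos : ∀ x ∈ Icc (0 : ℝ) 1, 0 < g x)
    (hdiff : ContDiffOn ℝ 1 g (Icc 0 1))
    (hderiv : ∀ x ∈ Icc (0 : ℝ) 1, 0 < derivWithin g (Icc 0 1) x) {s t : ℝ} (hs : 0 ≤ s)
    (hst : s ≤ t) (ht : t ≤ 1) : g s * Real.exp (lipMin g * (t - s)) ≤ g t := by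
  have hmin : ∀ x ∈ Icc (0 : ℝ) 1, lipMin g ≤ derivWithin g (Icc 0 1) x / g x := fun x hx ↦
    csInf_le ⟨0, by
      rintro _ ⟨z, hz, rfl⟩
      exact (div_pos (hderiv z hz) (hpos z hz)).le⟩ (mem_image_of_mem _ hx)
  have hd : ∀ x ∈ interior (Icc (0 : ℝ) 1),
      HasDerivAt (fun x ↦ Real.log (g x) - lipMin g * x)
        (derivWithin g (Icc 0 1) x / g x - lipMin g) x := fun x hx ↦ by
    have hx' := interior_subset hx
    have h1 : HasDerivAt g (derivWithin g (Icc 0 1) x) x :=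
      ((hdiff.differentiableOn one_ne_zero) x hx').hasDerivWithinAt.hasDerivAt
        (mem_interior_iff_mem_nhds.1 hx)
    simpa using (h1.log (hpos x hx').ne').fun_sub ((hasDerivAt_id x).const_mul (lipMin g))
  have hmono : MonotoneOn (fun x ↦ Real.log (g x) - lipMin g * x) (Icc 0 1) := by
    refine monotoneOn_of_deriv_nonneg (convex_Icc 0 1) ?_
      (fun x hx ↦ (hd x hx).differentiableAt.differentiableWithinAt) fun x hx ↦ ?_
    · exact (hdiff.continuousOn.log fun x hx ↦ (hpos x hx).ne').sub (by fun_prop)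
    · rw [(hd x hx).deriv]
      exact sub_nonneg.2 (hmin x (interior_subset hx))
  have hs' : s ∈ Icc (0 : ℝ) 1 := ⟨hs, hst.trans ht⟩
  have ht' : t ∈ Icc (0 : ℝ) 1 := ⟨hs.trans hst, ht⟩
  have h := hmono hs' ht' hst
  simp only at h
  rw [← Real.exp_log (hpos s hs'), ← Real.exp_log (hpos t ht'), ← Real.exp_add]
  exact Real.exp_le_exp.2 (by linarith)

variable {g : ℝ → ℝ → ℝ}

theorem IsWeightFamily.eventually_mul_le (hg : IsWeightFamily g) {s t : ℝ} (hs : 0 ≤ s)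
    (hst : s < t) (ht : t ≤ 1) (K : ℝ) : ∀ᶠ T in 𝓝[>] (0 : ℝ), K * g T s ≤ g T t := by
  have h1 : Tendsto (fun T ↦ Real.exp (lipMin (g T) * (t - s))) (𝓝[>] 0) atTop :=
    Real.tendsto_exp_atTop.comp (hg.tendsto_lipMin.atTop_mul_const (sub_pos.2 hst))
  filter_upwards [h1.eventually_ge_atTop K, self_mem_nhdsWithin] with T hK hT
  refine le_trans ?_ (mul_exp_lipMin_le (hg.pos T hT) (hg.contDiffOn T hT) (hg.deriv_pos T hT)
    hs hst.le ht)
  rw [mul_comm]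
  exact mul_le_mul_of_nonneg_left hK (hg.pos T hT s ⟨hs, hst.le.trans ht⟩).le

theorem IsWeightFamily.one_le (hg : IsWeightFamily g) {T : ℝ} (hT : 0 < T) {t : ℝ}
    (ht : t ∈ Icc (0 : ℝ) 1) : 1 ≤ g T t := by
  rw [← hg.map_zero T hT]
  exact (hg.strictMonoOn T hT).monotoneOn (left_mem_Icc.2 zero_le_one) ht ht.1

theorem IsWeightFamily.isPeaked (hg : IsWeightFamily g) {T : ℝ} (hT : 0 < T) {n : ℕ} [NeZero n]
    {ε : ℝ} (hε : 0 ≤ ε) (hε' : ε ≤ 1 / 2) {x : Fin n → ℝ} (hx : x ∈ simplexNear n ε) :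
    IsPeaked (g T ε) (g T (1 - ε)) (fun j ↦ g T (x j)) := by
  have hmono := (hg.strictMonoOn T hT).monotoneOn
  have hxI := mem_Icc_of_mem_stdSimplex hx.1
  have h1 : ε ∈ Icc (0 : ℝ) 1 := ⟨hε, by linarith⟩
  have h2 : 1 - ε ∈ Icc (0 : ℝ) 1 := ⟨by linarith, by linarith⟩
  refine ⟨hg.one_le hT h1, hmono h1 h2 (by linarith), hmono h2 (hxI 0) hx.2,
    fun j ↦ hg.one_le hT (hxI j), fun j hj ↦ hmono (hxI j) h1 ?_⟩
  have h3 : x 0 + x j ≤ 1 := by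
    rw [← hx.1.2, ← Finset.sum_pair hj.symm]
    exact Finset.sum_le_sum_of_subset_of_nonneg (Finset.subset_univ _) fun i _ _ ↦ hx.1.1 i
  linarith [hx.2]

/-- Brouwer's theorem applies once `u_T` maps `Σ_ε` into itself for all small `T`. -/
theorem IsWeightFamily.exists_forall_exists_isFixedPt (hg : IsWeightFamily g) {n : ℕ} [NeZero n]
    {C : Matrix (Fin n) (Fin n) ℝ} (hC : C.IsIrreducible) (h00 : 0 < C 0 0) {ε : ℝ} (hε : 0 ≤ ε)
    (h : ∀ᶠ T in 𝓝[>] (0 : ℝ), ∀ x ∈ simplexNear n ε, ∀ u,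
      IsInvariantMeasure (transitionMatrix C (g T) x) u → 1 - u 0 ≤ ε) :
    ∃ Tε : ℝ, 0 < Tε ∧ ∀ T : ℝ, 0 < T → T ≤ Tε →
      ∃ x ∈ simplexNear n ε, Function.IsFixedPt (uMap C (g T)) x := by
  obtain ⟨T₀, hT₀, hsub⟩ := mem_nhdsGT_iff_exists_Ioc_subset.1 h
  refine ⟨T₀, hT₀, fun T hT hTT₀ ↦ ?_⟩
  refine exists_isFixedPt_simplexNear hC h00 (hg.pos T hT) (hg.contDiffOn T hT).continuousOn hε
    fun x hx ↦ ?_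
  have := hsub ⟨hT, hTT₀⟩ x hx _ (isInvariantMeasure_uMap hC h00 (hg.pos T hT) hx.1)
  linarith

/-- The condition of the second part bounds `ε_n` as soon as there are two states. -/
theorem IsWeightFamily.le_half (hg : IsWeightFamily g) {m : ℕ} (hm : m ≠ 0) {δ : ℝ} (hδ : 0 < δ)
    (hδ1 : δ ≤ 1) (h : ∀ T : ℝ, 0 < T → g T δ ^ m ≤ g T (1 - δ)) : δ ≤ 1 / 2 := by
  by_contra! hlt
  have h1 : δ ∈ Icc (0 : ℝ) 1 := ⟨hδ.le, hδ1⟩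
  have h2 := hg.strictMonoOn 1 one_pos (a := 1 - δ) ⟨by linarith, by linarith⟩ h1 (by linarith)
  exact (h2.trans_le (le_self_pow₀ (hg.one_le one_pos h1) hm)).not_ge (h 1 one_pos)

end Weights

theorem mainTheorem3 (n : ℕ) [NeZero n] (C : Matrix (Fin n) (Fin n) ℝ)
    (hC : C.IsIrreducible) (g : ℝ → ℝ → ℝ) (hg : IsWeightFamily g) :
    ((∀ i, 0 < C i 0) →
      ∀ ε : ℝ, 0 < ε → ε < 1 / 2 →
        ∃ Tε : ℝ, 0 < Tε ∧ ∀ T : ℝ, 0 < T → T ≤ Tε →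
          ∃ x ∈ simplexNear n ε, Function.IsFixedPt (uMap C (g T)) x) ∧
    (0 < C 0 0 →
      ∀ εn : ℝ, 0 < εn → εn ≤ 1 →
        (∀ T : ℝ, 0 < T → g T εn ^ (n - 1) ≤ g T (1 - εn)) →
        ∀ ε : ℝ, 0 < ε → ε < εn →
          ∃ Tε : ℝ, 0 < Tε ∧ ∀ T : ℝ, 0 < T → T ≤ Tε →
            ∃ x ∈ simplexNear n ε, Function.IsFixedPt (uMap C (g T)) x) := by
  refine ⟨fun h0 ε hε hε2 ↦ ?_, fun h00 εn hεn hεn1 hgn ε hε hεεn ↦ ?_⟩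
  · refine hg.exists_forall_exists_isFixedPt hC (h0 0) hε.le ?_
    obtain ⟨c, hc, hcu⟩ := exists_one_sub_apply_zero_le_of_forall_pos hC h0
    filter_upwards [hg.eventually_mul_le hε.le (show ε < 1 - ε by linarith) (by linarith) (c / ε),
      self_mem_nhdsWithin] with T hK hT x hx u hu
    have hp := hg.isPeaked hT hε.le hε2.le hx
    have hb : 0 < g T (1 - ε) := one_pos.trans_le (hp.one_le.trans hp.le)
    refine (hcu _ _ _ _ _ hp hu).trans ?_
    rw [div_mul_eq_mul_div, div_le_iff₀ hε] at hK
    rwa [mul_div_assoc', div_le_iff₀ hb, mul_comm ε]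
  · refine hg.exists_forall_exists_isFixedPt hC h00 hε.le ?_
    rcases eq_or_ne (n - 1) 0 with hn | hn
    · -- with a single state, the simplex is a point
      have hn1 : n = 1 := by have := NeZero.pos n; omega
      subst hn1
      filter_upwards with T x hx u hu
      have := hu.1.2
      rw [Fin.sum_univ_one] at this
      linarith
    · have hhalf := hg.le_half hn hεn hεn1 hgn
      obtain ⟨c, hc, hcu⟩ := exists_one_sub_apply_zero_le hC h00
      set K := max 1 (c / ε) with hK
      filter_upwards [hg.eventually_mul_le hε.le hεεn hεn1 K, self_mem_nhdsWithin]
        with T hKT hT x hx u hu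
      have hT : 0 < T := hT
      have hp := hg.isPeaked hT hε.le (hεεn.le.trans hhalf) hx
      have ha : 0 < g T ε := one_pos.trans_le hp.one_le
      have hb : 0 < g T (1 - ε) := ha.trans_le hp.le
      refine (hcu _ _ _ _ _ hp hu).trans ?_
      have hK1 : 1 ≤ K := le_max_left _ _
      have hchain : K * g T ε ^ (n - 1) ≤ g T (1 - ε) :=
        calc K * g T ε ^ (n - 1) ≤ K ^ (n - 1) * g T ε ^ (n - 1) := by
              gcongr
              exact le_self_pow₀ hK1 hn
          _ = (K * g T ε) ^ (n - 1) := (mul_pow _ _ _).symm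
          _ ≤ g T εn ^ (n - 1) := by gcongr
          _ ≤ g T (1 - εn) := hgn T hT
          _ ≤ g T (1 - ε) := (hg.strictMonoOn T hT).monotoneOn ⟨by linarith, by linarith⟩
              ⟨by linarith, by linarith⟩ (by linarith)
      have h1 : c / ε * g T ε ^ (n - 1) ≤ g T (1 - ε) :=
        (mul_le_mul_of_nonneg_right (le_max_right _ _) (by positivity)).trans hchain
      rw [div_mul_eq_mul_div, div_le_iff₀ hε] at h1
      rwa [mul_div_assoc', div_le_iff₀ hb, mul_comm ε]
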